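/- **Theorem 3.2.** Let $K$ be an algebraically closed field of characteristic zero and let $n\ge 0$. (a) Let $(A,\mathfrak m)$ be an Artinian local $K$-algebra with Hilbert function $\{1,n,n,1\}$, that is, $\dim_K \mathfrak m^i/\mathfrak m^{i+1}=1,n,n,1$ for $i=0,1,2,3$ and $=0$ for $i\ge 4$. If $A$ is Gorenstein, i.e. its socle $0:\mathfrak m$ is one-dimensional over $K$, then $A$ is canonically graded: $A\simeq gr_{\mathfrak m}(A)=\bigoplus_{i\ge 0}\mathfrak m^i/\mathfrak m^{i+1}$ as $K$-algebras. Let $R=K[\![x_1,\dots,x_n]\!]$ act on $P=K[y_1,\dots,y_n]$ by $f\circ g=f(\partial_{y_1},\dots,\partial_{y_n})(g)$, and for $F\in P$ put $Ann_R(F)=\{f\in R: f\circ F=0\}$ and $A_F=R/Ann_R(F)$. Let $F_3\in P$ be a cubic form which is non-degenerate, i.e. $\dim_K \mathfrak n/\mathfrak n^2=n$, where $\mathfrak n$ is the ideal of $A_{F_3}$ generated by the images of $x_1,\dots,x_n$. (b) For every quadratic form $F_2\in P$ (possibly zero), $A_{F_3}\simeq A_{F_3+F_2}$ as $K$-algebras.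 (c) Write $F_3=\sum_{|\underline i|=3}\alpha_{\underline i}\,\frac{1}{\underline i!}\,y^{\underline i}$ and let $\Delta_{F_3}$ be the $n\times\binom{n+1}{2}$ matrix with entries $(\Delta_{F_3})_{j,\underline i}=\alpha_{\underline i+\delta_j}$, for $1\le j\le n$ and multi-indices $\underline i\in\mathbb N^n$ with $|\underline i|=2$, where $\delta_j$ is the $j$-th unit vector. Let $M_{F_3}$ be the $\binom{n+1}{2}\times n\binom{n+1}{2}$ matrix with rows indexed by the pairs $(l,j)$, $1\le l\le j\le n$, columns indexed by the pairs $(k,\underline i)$, $1\le k\le n$, $|\underline i|=2$, and entries $$(M_{F_3})_{(l,j),(k,\underline i)}=[k=l]\,(\Delta_{F_3})_{j,\underline i}+[k=j]\,(\Delta_{F_3})_{l,\underline i},$$ where $[\,\cdot\,]$ is $1$ if the condition holds and $0$ otherwise. Then $M_{F_3}$ has maximal rank $\binom{n+1}{2}$. -/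

import Mathlib

open scoped DirectSum

/-! ### Associated graded ring and Hilbert function -/

namespace InverseSystem

section AssociatedGraded

variable {A : Type*} [CommRing A]

/-- The `i`-th graded piece `I ^ i / I ^ (i + 1)` of the `I`-adic filtration. -/
def GrPiece (I : Ideal A) (i : ℕ) : Type _ :=
  ↥(I ^ i) ⧸ (I ^ (i + 1)).submoduleOf (I ^ i)

instance (I : Ideal A) (i : ℕ) : AddCommGroup (GrPiece I i) :=
  inferInstanceAs (AddCommGroup (↥(I ^ i) ⧸ (I ^ (i + 1)).submoduleOf (I ^ i)))

instance {K : Type*} [CommRing K] [Algebra K A] (I : Ideal A) (i : ℕ) : Module K (GrPiece I i) :=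
  inferInstanceAs (Module K (↥(I ^ i) ⧸ (I ^ (i + 1)).submoduleOf (I ^ i)))

/-- The class in `I ^ i / I ^ (i + 1)` of an element `a` of `I ^ i`. -/
def GrPiece.mk (I : Ideal A) (i : ℕ) : ↥(I ^ i) →+ GrPiece I i :=
  ((I ^ (i + 1)).submoduleOf (I ^ i)).mkQ.toAddMonoidHom

theorem GrPiece.mk_surjective (I : Ideal A) (i : ℕ) : Function.Surjective (GrPiece.mk I i) :=
  Submodule.mkQ_surjective _

theorem GrPiece.mk_eq_zero (I : Ideal A) (i : ℕ) (a : ↥(I ^ i)) :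
    GrPiece.mk I i a = 0 ↔ (a : A) ∈ I ^ (i + 1) :=
  Submodule.Quotient.mk_eq_zero _

theorem GrPiece.smul_mk {K : Type*} [CommRing K] [Algebra K A] (I : Ideal A) (i : ℕ) (c : K)
    (a : ↥(I ^ i)) : c • GrPiece.mk I i a = GrPiece.mk I i (c • a) :=
  rfl

/-- Multiplication `I ^ i × I ^ j → I ^ (i + j) / I ^ (i + j + 1)`. -/
def GrPiece.preMul (I : Ideal A) (i j : ℕ) : ↥(I ^ i) →+ ↥(I ^ j) →+ GrPiece I (i + j) :=
  AddMonoidHom.mk' (fun a => AddMonoidHom.mk' (fun b => GrPiece.mk I (i + j)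
      ⟨a * b, pow_add I i j ▸ Ideal.mul_mem_mul a.2 b.2⟩)
    (fun b c => by rw [← map_add]; congr 1; ext; simp [mul_add]))
    (fun a b => by ext c; simp only [AddMonoidHom.add_apply, AddMonoidHom.mk'_apply]
                   rw [← map_add]; congr 1; ext; simp [add_mul])

/-- Multiplication `I ^ i / I ^ (i + 1) × I ^ j / I ^ (j + 1) → I ^ (i + j) / I ^ (i + j + 1)`,
the class of `a` times the class of `b` being the class of `a * b`. -/
def GrPiece.mul (I : Ideal A) (i j : ℕ) : GrPiece I i →+ GrPiece I j →+ GrPiece I (i + j) :=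
  QuotientAddGroup.lift ((I ^ (i + 1)).submoduleOf (I ^ i)).toAddSubgroup
    (AddMonoidHom.mk' (fun a => QuotientAddGroup.lift
      ((I ^ (j + 1)).submoduleOf (I ^ j)).toAddSubgroup (GrPiece.preMul I i j a) (by
        intro b hb
        refine (GrPiece.mk_eq_zero I (i + j) _).2 ?_
        have hb' : (b : A) ∈ I ^ (j + 1) := hb
        have := Ideal.mul_mem_mul a.2 hb'
        rwa [← pow_add, ← add_assoc] at this))
      (fun a b => by
        ext c
        obtain ⟨c, rfl⟩ := GrPiece.mk_surjective I j c
        exact DFunLike.congr_fun (map_add (GrPiece.preMul I i j) a b) c))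
    (by
      intro a ha
      ext b
      obtain ⟨b, rfl⟩ := GrPiece.mk_surjective I j b
      refine (GrPiece.mk_eq_zero I (i + j) _).2 ?_
      have ha' : (a : A) ∈ I ^ (i + 1) := ha
      have := Ideal.mul_mem_mul ha' b.2
      rwa [← pow_add, add_right_comm] at this)

theorem GrPiece.mul_mk (I : Ideal A) (i j : ℕ) (a : ↥(I ^ i)) (b : ↥(I ^ j)) :
    GrPiece.mul I i j (GrPiece.mk I i a) (GrPiece.mk I j b) =
      GrPiece.mk I (i + j) ⟨a * b, pow_add I i j ▸ Ideal.mul_mem_mul a.2 b.2⟩ :=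
  rfl

theorem GrPiece.mk_congr (I : Ideal A) {i j : ℕ} (h : i = j) (a : ↥(I ^ i)) (b : ↥(I ^ j))
    (hab : (a : A) = b) :
    (GradedMonoid.mk i (GrPiece.mk I i a) : GradedMonoid (GrPiece I)) =
      GradedMonoid.mk j (GrPiece.mk I j b) := by
  subst h
  congr 2
  exact Subtype.ext hab

/-- The element of degree zero given by `a`. -/
def GrPiece.zeroMk (I : Ideal A) : A →+ GrPiece I 0 :=
  (GrPiece.mk I 0).comp (AddMonoidHom.mk' (fun a => ⟨a, by simp⟩) (fun _ _ => rfl))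

instance (I : Ideal A) : GradedMonoid.GMul (GrPiece I) where
  mul {i j} a b := GrPiece.mul I i j a b

instance (I : Ideal A) : GradedMonoid.GOne (GrPiece I) where
  one := GrPiece.zeroMk I 1

instance (I : Ideal A) : DirectSum.GCommRing (GrPiece I) where
  mul_zero a := map_zero (GrPiece.mul I _ _ a)
  zero_mul b := by
    change GrPiece.mul I _ _ 0 b = 0
    rw [map_zero]; rfl
  mul_add a b c := map_add (GrPiece.mul I _ _ a) b c
  add_mul a b c := by
    change GrPiece.mul I _ _ (a + b) c = _
    rw [map_add]; rfl
  one_mul := by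
    rintro ⟨i, a⟩
    obtain ⟨a, rfl⟩ := GrPiece.mk_surjective I i a
    exact GrPiece.mk_congr I (zero_add i) _ _ (one_mul _)
  mul_one := by
    rintro ⟨i, a⟩
    obtain ⟨a, rfl⟩ := GrPiece.mk_surjective I i a
    exact GrPiece.mk_congr I (add_zero i) _ _ (mul_one _)
  mul_assoc := by
    rintro ⟨i, a⟩ ⟨j, b⟩ ⟨k, c⟩
    obtain ⟨a, rfl⟩ := GrPiece.mk_surjective I i a
    obtain ⟨b, rfl⟩ := GrPiece.mk_surjective I j b
    obtain ⟨c, rfl⟩ := GrPiece.mk_surjective I k c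
    exact GrPiece.mk_congr I (add_assoc i j k) _ _ (mul_assoc _ _ _)
  mul_comm := by
    rintro ⟨i, a⟩ ⟨j, b⟩
    obtain ⟨a, rfl⟩ := GrPiece.mk_surjective I i a
    obtain ⟨b, rfl⟩ := GrPiece.mk_surjective I j b
    exact GrPiece.mk_congr I (add_comm i j) _ _ (mul_comm _ _)
  natCast n := GrPiece.zeroMk I n
  natCast_zero := by simp
  natCast_succ n := by
    rw [Nat.cast_succ, map_add]; rfl
  intCast n := GrPiece.zeroMk I n
  intCast_ofNat n := by simp
  intCast_negSucc_ofNat n := by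
    rw [Int.cast_negSucc, map_neg]

instance {K : Type*} [CommRing K] [Algebra K A] (I : Ideal A) :
    DirectSum.GAlgebra K (GrPiece I) where
  toFun := (GrPiece.zeroMk I).comp (algebraMap K A).toAddMonoidHom
  map_one := by
    change GrPiece.zeroMk I (algebraMap K A 1) = GrPiece.zeroMk I 1
    rw [map_one]
  map_mul r s := GrPiece.mk_congr I (add_zero 0).symm _ _ (map_mul (algebraMap K A) r s)
  commutes r := by
    rintro ⟨i, a⟩
    obtain ⟨a, rfl⟩ := GrPiece.mk_surjective I i a
    exact GrPiece.mk_congr I (add_comm 0 i) _ _ (mul_comm _ _)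
  smul_def r := by
    rintro ⟨i, a⟩
    obtain ⟨a, rfl⟩ := GrPiece.mk_surjective I i a
    exact GrPiece.mk_congr I (zero_add i).symm _ _ (Algebra.smul_def r (a : A))

/-- The associated graded ring `gr_I(A) = ⨁ i, I ^ i / I ^ (i + 1)`. -/
abbrev AssociatedGraded (I : Ideal A) : Type _ :=
  ⨁ i, GrPiece I i

/-- The Hilbert function `i ↦ dim_K (I ^ i / I ^ (i + 1))`; used for `I` a maximal ideal. -/
noncomputable def hilbertFunction (K : Type*) [Field K] [Algebra K A] (I : Ideal A) (i : ℕ) : ℕ :=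
  Module.finrank K (GrPiece I i)

/-- An Artinian local `K`-algebra `A` (with residue field `K`) is Gorenstein if its socle
`0 : 𝔪` is one-dimensional over `K`. -/
def IsArtinianGorenstein (K A : Type*) [Field K] [CommRing A] [Algebra K A] [IsLocalRing A] :
    Prop :=
  IsArtinianRing A ∧
    Module.finrank K ↥((⊥ : Ideal A).colon (IsLocalRing.maximalIdeal A : Set A)) = 1

/-- The local `K`-algebra `A` is canonically graded if it is isomorphic, as a `K`-algebra, to its
associated graded ring `gr_𝔪(A)`. -/
def IsCanonicallyGraded (K A : Type*) [Field K] [CommRing A] [Algebra K A] [IsLocalRing A] : Prop :=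
  Nonempty (A ≃ₐ[K] AssociatedGraded (IsLocalRing.maximalIdeal A))

end AssociatedGraded

/-! ### Macaulay's inverse system -/

section Macaulay

variable {K : Type*} [Field K] {n : ℕ}

/-- The action `f ∘ g = f(∂₁, …, ∂ₙ) g` of a power series `f` on a polynomial `g` by
differentiation: it is `K`-linear in `g`, and
`f ∘ y ^ β = ∑_{α + γ = β} f_α * (β! / γ!) y ^ γ`. -/
noncomputable def diffAct (f : MvPowerSeries (Fin n) K) :
    MvPolynomial (Fin n) K →ₗ[K] MvPolynomial (Fin n) K :=
  (MvPolynomial.basisMonomials (Fin n) K).constr K fun β =>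
    ∑ p ∈ Finset.HasAntidiagonal.antidiagonal β, MvPolynomial.monomial p.2
      (MvPowerSeries.coeff p.1 f * ((∏ i, (β i).descFactorial (p.1 i) : ℕ) : K))

theorem diffAct_monomial (f : MvPowerSeries (Fin n) K) (β : Fin n →₀ ℕ) :
    diffAct f (MvPolynomial.monomial β 1) =
      ∑ p ∈ Finset.HasAntidiagonal.antidiagonal β, MvPolynomial.monomial p.2
        (MvPowerSeries.coeff p.1 f * ((∏ i, (β i).descFactorial (p.1 i) : ℕ) : K)) := by
  have := (MvPolynomial.basisMonomials (Fin n) K).constr_basis K (fun β =>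
    ∑ p ∈ Finset.HasAntidiagonal.antidiagonal β, MvPolynomial.monomial p.2
      (MvPowerSeries.coeff p.1 f * ((∏ i, (β i).descFactorial (p.1 i) : ℕ) : K))) β
  rwa [MvPolynomial.coe_basisMonomials] at this

theorem diffAct_ext {φ ψ : MvPolynomial (Fin n) K →ₗ[K] MvPolynomial (Fin n) K}
    (h : ∀ β, φ (MvPolynomial.monomial β 1) = ψ (MvPolynomial.monomial β 1)) : φ = ψ := by
  refine (MvPolynomial.basisMonomials (Fin n) K).ext fun β => ?_
  simpa [MvPolynomial.coe_basisMonomials] using h β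

theorem diffAct_add (f h : MvPowerSeries (Fin n) K) : diffAct (f + h) = diffAct f + diffAct h := by
  refine diffAct_ext fun β => ?_
  simp only [LinearMap.add_apply, diffAct_monomial, map_add, add_mul, Finset.sum_add_distrib]

theorem diffAct_smul (c : K) (f : MvPowerSeries (Fin n) K) : diffAct (c • f) = c • diffAct f := by
  refine diffAct_ext fun β => ?_
  simp only [LinearMap.smul_apply, diffAct_monomial, Finset.smul_sum, MvPolynomial.smul_monomial,
    map_smul, smul_eq_mul, mul_assoc]

theorem diffAct_mul (f h : MvPowerSeries (Fin n) K) :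
    diffAct (f * h) = diffAct f ∘ₗ diffAct h := by
  classical
  refine diffAct_ext fun β => ?_
  have key : ∀ (γ : Fin n →₀ ℕ) (c : K), MvPolynomial.monomial γ c =
      c • MvPolynomial.monomial γ (1 : K) := fun γ c => by simp [MvPolynomial.smul_monomial]
  rw [LinearMap.comp_apply, diffAct_monomial, diffAct_monomial, map_sum]
  simp_rw [MvPowerSeries.coeff_mul]
  have : ∀ p : (Fin n →₀ ℕ) × (Fin n →₀ ℕ), diffAct f (MvPolynomial.monomial p.2
      (MvPowerSeries.coeff p.1 h * ((∏ i, (β i).descFactorial (p.1 i) : ℕ) : K))) =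
      ∑ q ∈ Finset.HasAntidiagonal.antidiagonal p.2, MvPolynomial.monomial q.2
        (MvPowerSeries.coeff p.1 h * ((∏ i, (β i).descFactorial (p.1 i) : ℕ) : K) *
        (MvPowerSeries.coeff q.1 f * ((∏ i, (p.2 i).descFactorial (q.1 i) : ℕ) : K))) := by
    intro p
    rw [key, map_smul, diffAct_monomial, Finset.smul_sum]
    simp [MvPolynomial.smul_monomial]
  simp_rw [this, Finset.sum_mul, map_sum]
  rw [Finset.sum_sigma', Finset.sum_sigma']
  refine Finset.sum_nbij' (fun x => ⟨(x.2.2, x.2.1 + x.1.2), (x.2.1, x.1.2)⟩)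
    (fun x => ⟨(x.2.1 + x.1.1, x.2.2), (x.2.1, x.1.1)⟩) ?_ ?_ ?_ ?_ ?_
  · rintro ⟨⟨a, b⟩, ⟨c, d⟩⟩ hx
    simp only [Finset.mem_sigma, Finset.HasAntidiagonal.mem_antidiagonal] at hx ⊢
    obtain ⟨rfl, rfl⟩ := hx
    exact ⟨by abel, trivial⟩
  · rintro ⟨⟨a, b⟩, ⟨c, d⟩⟩ hx
    simp only [Finset.mem_sigma, Finset.HasAntidiagonal.mem_antidiagonal] at hx ⊢
    obtain ⟨rfl, rfl⟩ := hx
    exact ⟨by abel, trivial⟩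
  · rintro ⟨⟨a, b⟩, ⟨c, d⟩⟩ hx
    simp only [Finset.mem_sigma, Finset.HasAntidiagonal.mem_antidiagonal] at hx ⊢
    obtain ⟨rfl, rfl⟩ := hx
    rfl
  · rintro ⟨⟨a, b⟩, ⟨c, d⟩⟩ hx
    simp only [Finset.mem_sigma, Finset.HasAntidiagonal.mem_antidiagonal] at hx ⊢
    obtain ⟨rfl, rfl⟩ := hx
    rfl
  · rintro ⟨⟨a, b⟩, ⟨c, d⟩⟩ hx
    simp only [Finset.mem_sigma, Finset.HasAntidiagonal.mem_antidiagonal] at hx ⊢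
    obtain ⟨rfl, rfl⟩ := hx
    congr 1
    have h1 : (∏ i, ((c + d + b) i).descFactorial ((c + d) i)) =
        (∏ i, ((c + d + b) i).descFactorial (d i)) * ∏ i, ((c + b) i).descFactorial (c i) := by
      rw [← Finset.prod_mul_distrib]
      refine Finset.prod_congr rfl fun i _ => ?_
      have := Nat.descFactorial_mul_descFactorial (n := (c + d + b) i) (k := d i)
        (m := (c + d) i) (by simp)
      rw [← this, mul_comm]
      congr 2
      · simp only [Finsupp.add_apply]; omega
      · simp
    rw [h1, Nat.cast_mul]
    ring

/-- The annihilator `Ann_R(F)` in `R = K⟦x₁, …, xₙ⟧` of a polynomial `F`. -/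
noncomputable def annihilator (F : MvPolynomial (Fin n) K) : Ideal (MvPowerSeries (Fin n) K) where
  carrier := {f | diffAct f F = 0}
  zero_mem' := by
    have := diffAct_smul (0 : K) (0 : MvPowerSeries (Fin n) K)
    simp only [zero_smul] at this
    simp [this]
  add_mem' {f h} hf hh := by
    simp only [Set.mem_ofPred_eq] at hf hh ⊢
    simp [diffAct_add, hf, hh]
  smul_mem' f h hh := by
    simp only [Set.mem_ofPred_eq] at hh ⊢
    simp [diffAct_mul, hh]

/-- The algebra `A_F = R / Ann_R(F)` with inverse system generated by `F`. -/
abbrev MacaulayAlgebra (F : MvPolynomial (Fin n) K) : Type _ :=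
  MvPowerSeries (Fin n) K ⧸ annihilator F

/-- The image in `A_F` of the maximal ideal `(x₁, …, xₙ)` of `R`. -/
noncomputable def maxIdeal (F : MvPolynomial (Fin n) K) : Ideal (MacaulayAlgebra F) :=
  (Ideal.span (Set.range (MvPowerSeries.X : Fin n → MvPowerSeries (Fin n) K))).map
    (Ideal.Quotient.mk (annihilator F))

/-- `F ∈ K[y₁, …, yₙ]` is non-degenerate if `A_F` has embedding dimension `n`. -/
def NonDegenerate (F : MvPolynomial (Fin n) K) : Prop :=
  hilbertFunction K (maxIdeal F) 1 = n

/-- The multi-indices `i ∈ ℕⁿ` with `|i| = 2`. -/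
abbrev DegreeTwoIndex (n : ℕ) : Type :=
  ↥((Finset.univ : Finset (Fin n)).finsuppAntidiag 2)

/-- The coefficient `α_i` of `F` in the dual basis: `F = ∑ i, α_i y ^ i / i!`. -/
noncomputable def dualCoeff (F : MvPolynomial (Fin n) K) (i : Fin n →₀ ℕ) : K :=
  ((∏ k, (i k).factorial : ℕ) : K) * F.coeff i

/-- The `n × (n+1 choose 2)` matrix `Δ_F` of second derivatives of a cubic form:
its entry at `(j, i)` is `α_{i + δ_j}`, the coefficient of `y_j` in `∂_i F`. -/
noncomputable def Delta (F : MvPolynomial (Fin n) K) : Matrix (Fin n) (DegreeTwoIndex n) K :=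
  Matrix.of fun j i => dualCoeff F (i.1 + Finsupp.single j 1)

/-- The `(n+1 choose 2) × n (n+1 choose 2)` matrix `M_F` of a cubic form. Its rows are indexed by
the pairs `(l, j)` with `l ≤ j` (the monomials `x_l x_j`), its columns by the pairs `(k, i)`
(the indeterminates `a_i^k`). The column `(l, i)` has the entry `Δ_{j,i}` and the column `(j, i)`
the entry `Δ_{l,i}` in the row `(l, j)` if `l < j`; the column `(l, i)` has the entry `2 Δ_{l,i}`
in the row `(l, l)`; all other entries vanish. -/
noncomputable def bigMatrix (F : MvPolynomial (Fin n) K) :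
    Matrix {p : Fin n × Fin n // p.1 ≤ p.2} (Fin n × DegreeTwoIndex n) K :=
  Matrix.of fun p c =>
    (if c.1 = p.1.1 then Delta F p.1.2 c.2 else 0) + (if c.1 = p.1.2 then Delta F p.1.1 c.2 else 0)

end Macaulay

end InverseSystem

/-! (a) Put I = 𝔪. A subspace V with I = V ⊕ I² and V² ∩ I³ = 0 splits the whole I-adic filtration
by its powers, since I⁴ = 0; as VⁱVʲ ⊆ Vⁱ⁺ʲ, the splitting is an algebra isomorphism with gr(A). To
find V, take any complement W of I² in I and a functional φ injective on I³, which is the socle. The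
pairing φ(qw) of I² with W has left kernel I³ and, as dim I/I² = dim I²/I³, induces a surjection I²
→ W*. So there is θ : W → I² with φ(θ(v)w) = -φ(vw)/2, and V = {w + θ(w)} satisfies φ(V²) = 0
(`exists_complement_sq_disjoint`).

(b) Ann(F) is the largest ideal in the kernel of the functional f ↦ (f ∘ F)(0)
(`mem_annihilator_iff`), so it suffices to find a substitution carrying the functional of F₃ + F₂ to
that of F₃. It is x_j ↦ x_j + q_j + x_j r_j with quadrics q_j, r_j: the q_j cancel F₂ on products of
two variables, and the r_j repair the error which this causes on single variables.

(c) The same fact gives the rank and the quadrics: non-degeneracy makes the rows of Δ independent,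
so Δ is surjective (`mulVec_Delta_surjective`). The system of M then asks for vectors aˡ with
(Δaˡ)_j + (Δaʲ)_l = t_{lj}, solved by making Δaˡ the row l of the symmetric matrix t/2. -/

namespace InverseSystem

/-! ### Splitting the filtration by powers of a nilpotent ideal -/

section Filtration

variable {K A : Type*} [Field K] [CommRing A] [Algebra K A]

/-- The `K`-linear version of `GrPiece.mk`. -/
def GrPiece.mkLinear (K : Type*) {A : Type*} [Field K] [CommRing A] [Algebra K A] (I : Ideal A)
    (i : ℕ) : ↥((I ^ i).restrictScalars K) →ₗ[K] GrPiece I i where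
  toFun a := GrPiece.mk I i a
  map_add' a b := map_add (GrPiece.mk I i) a b
  map_smul' c a := (GrPiece.smul_mk I i c a).symm

theorem GrPiece.mkLinear_eq_zero (I : Ideal A) (i : ℕ) (a : ↥((I ^ i).restrictScalars K)) :
    GrPiece.mkLinear K I i a = 0 ↔ (a : A) ∈ I ^ (i + 1) :=
  GrPiece.mk_eq_zero I i a

theorem GrPiece.mkLinear_surjective (I : Ideal A) (i : ℕ) :
    Function.Surjective (GrPiece.mkLinear K I i) :=
  GrPiece.mk_surjective I i

theorem restrictScalars_pow_succ (I : Ideal A) (i : ℕ) :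
    (I ^ (i + 1)).restrictScalars K = (I ^ i).restrictScalars K * I.restrictScalars K := by
  rw [pow_succ]
  exact Ideal.restrictScalars_mul _ I

theorem pow_le_restrictScalars_pow {I : Ideal A} {V : Submodule K A}
    (hV : V ≤ I.restrictScalars K) (i : ℕ) : V ^ i ≤ (I ^ i).restrictScalars K := by
  induction i with
  | zero => simp
  | succ i ih =>
    rw [pow_succ, restrictScalars_pow_succ]
    exact mul_le_mul' ih hV

/-- Expanding (v + c)(w + d) with v ∈ Vⁱ, c ∈ Iⁱ⁺¹, w ∈ V, d ∈ I², every term but vw lies in Iⁱ⁺².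
-/
theorem restrictScalars_pow_le_sup {I : Ideal A} {V : Submodule K A}
    (hV : V ≤ I.restrictScalars K) (h₀ : ⊤ ≤ 1 ⊔ I.restrictScalars K)
    (h₁ : I.restrictScalars K ≤ V ⊔ (I ^ 2).restrictScalars K) (i : ℕ) :
    (I ^ i).restrictScalars K ≤ V ^ i ⊔ (I ^ (i + 1)).restrictScalars K := by
  induction i with
  | zero => simpa using h₀
  | succ i ih =>
    have hVi := pow_le_restrictScalars_pow hV i
    rw [restrictScalars_pow_succ, Submodule.mul_le]
    intro a ha b hb
    obtain ⟨v, hv, c, hc, rfl⟩ := Submodule.mem_sup.1 (ih ha)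
    obtain ⟨w, hw, d, hd, rfl⟩ := Submodule.mem_sup.1 (h₁ hb)
    refine Submodule.mem_sup.2 ⟨v * w, ?_, v * d + c * (w + d), ?_, by ring⟩
    · rw [pow_succ]
      exact Submodule.mul_mem_mul hv hw
    · refine add_mem ?_ ?_
      · have := Ideal.mul_mem_mul (hVi hv) hd
        rwa [← pow_add] at this
      · have := Ideal.mul_mem_mul hc hb
        rwa [← pow_succ] at this

/-- As A = K + I, each coefficient of a combination of generators is a scalar up to an element of I,
and the latter only contributes to I². -/
theorem restrictScalars_le_span_sup_sq {I : Ideal A} {s : Set A} (hs : I = Ideal.span s)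
    (h₀ : ⊤ ≤ 1 ⊔ I.restrictScalars K) :
    I.restrictScalars K ≤ Submodule.span K s ⊔ (I ^ 2).restrictScalars K := by
  intro x hx
  have hx' : x ∈ Ideal.span s := hs ▸ (show x ∈ I from hx)
  induction hx' using Submodule.span_induction with
  | mem x h => exact Submodule.mem_sup_left (Submodule.subset_span h)
  | zero => exact zero_mem _
  | add x y hxs hys ihx ihy =>
    exact add_mem (ihx (show x ∈ I from hs ▸ hxs)) (ihy (show y ∈ I from hs ▸ hys))
  | smul a x hxs ih =>
    have hxI : x ∈ I := hs ▸ hxs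
    obtain ⟨b, hb, c, hc, rfl⟩ := Submodule.mem_sup.1 (h₀ (Submodule.mem_top (x := a)))
    obtain ⟨t, rfl⟩ := Submodule.mem_one.1 hb
    rw [smul_eq_mul, add_mul, ← Algebra.smul_def]
    refine add_mem (Submodule.smul_mem _ _ (ih hxI)) (Submodule.mem_sup_right ?_)
    rw [Submodule.restrictScalars_mem, pow_two]
    exact Ideal.mul_mem_mul hc hxI

theorem adjoin_eq_top_of_isNilpotent {I : Ideal A} (hI : IsNilpotent I) {V : Submodule K A}
    (hV : V ≤ I.restrictScalars K) (h₀ : ⊤ ≤ 1 ⊔ I.restrictScalars K)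
    (h₁ : I.restrictScalars K ≤ V ⊔ (I ^ 2).restrictScalars K) :
    Algebra.adjoin K (V : Set A) = ⊤ := by
  have hpow (i : ℕ) : V ^ i ≤ Subalgebra.toSubmodule (Algebra.adjoin K (V : Set A)) := by
    induction i with
    | zero => simp
    | succ i ih =>
      rw [pow_succ, Submodule.mul_le]
      exact fun a ha b hb => Subalgebra.mul_mem _ (ih ha) (Algebra.subset_adjoin hb)
  have key (k : ℕ) : ⊤ ≤ Subalgebra.toSubmodule (Algebra.adjoin K (V : Set A)) ⊔
      (I ^ k).restrictScalars K := by
    induction k with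
    | zero => simp
    | succ k ih =>
      refine ih.trans (sup_le le_sup_left ((restrictScalars_pow_le_sup hV h₀ h₁ k).trans ?_))
      exact sup_le_sup_right (hpow k) _
  obtain ⟨N, hN⟩ := hI
  have := key N
  rw [hN] at this
  refine top_le_iff.1 fun x _ => ?_
  simpa using this (Submodule.mem_top (x := x))

/-- Modulo Iᵏ the algebra is spanned by the first k powers of the span of finitely many generators
of I; nilpotency ends the process. -/
theorem finite_of_isNilpotent {I : Ideal A} (hI : IsNilpotent I) (hfg : I.FG)
    (h₀ : ⊤ ≤ 1 ⊔ I.restrictScalars K) : Module.Finite K A := by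
  obtain ⟨s, hs⟩ := hfg
  have hsI : Submodule.span K (s : Set A) ≤ I.restrictScalars K :=
    Submodule.span_le.2 fun x hx => hs ▸ Ideal.subset_span hx
  have h₁ := restrictScalars_le_span_sup_sq hs.symm h₀
  have key (k : ℕ) : ∃ W : Submodule K A, W.FG ∧ ⊤ ≤ W ⊔ (I ^ k).restrictScalars K := by
    induction k with
    | zero => exact ⟨⊥, Submodule.fg_bot, by simp⟩
    | succ k ih =>
      obtain ⟨W, hW, h⟩ := ih
      refine ⟨W ⊔ Submodule.span K (s : Set A) ^ k,
        hW.sup (Submodule.FG.pow (Submodule.fg_span s.finite_toSet) k), h.trans ?_⟩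
      rw [sup_assoc]
      exact sup_le_sup_left (restrictScalars_pow_le_sup hsI h₀ h₁ k) _
  obtain ⟨N, hN⟩ := hI
  obtain ⟨W, hW, h⟩ := key N
  rw [hN] at h
  have : W = ⊤ := top_le_iff.1 fun x _ => by simpa using h (Submodule.mem_top (x := x))
  exact ⟨this ▸ hW⟩

/-- A `K`-algebra is isomorphic to the associated graded ring of a nilpotent ideal `I` as soon as
some subspace `V` satisfies `I ^ i = V ^ i ⊕ I ^ (i + 1)` for all `i`. -/
theorem nonempty_algEquiv_associatedGraded {I : Ideal A} (hI : IsNilpotent I) {V : Submodule K A}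
    (hV : V ≤ I.restrictScalars K)
    (hsup : ∀ i, (I ^ i).restrictScalars K ≤ V ^ i ⊔ (I ^ (i + 1)).restrictScalars K)
    (hinf : ∀ i, ∀ x ∈ V ^ i, x ∈ I ^ (i + 1) → x = 0) :
    Nonempty (A ≃ₐ[K] AssociatedGraded I) := by
  classical
  have hVi := pow_le_restrictScalars_pow hV
  let e (i : ℕ) : ↥(V ^ i) ≃ₗ[K] GrPiece I i :=
    LinearEquiv.ofBijective (GrPiece.mkLinear K I i ∘ₗ Submodule.inclusion (hVi i)) <| by
      constructor
      · rw [← LinearMap.ker_eq_bot, LinearMap.ker_eq_bot']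
        intro x hx
        exact Subtype.ext (hinf i x x.2 ((GrPiece.mkLinear_eq_zero I i _).1 hx))
      · intro y
        obtain ⟨a, rfl⟩ := GrPiece.mkLinear_surjective (K := K) I i y
        obtain ⟨v, hv, c, hc, hvc⟩ := Submodule.mem_sup.1 (hsup i a.2)
        refine ⟨⟨v, hv⟩, ?_⟩
        rw [← sub_eq_zero, LinearMap.comp_apply, ← map_sub, GrPiece.mkLinear_eq_zero]
        have : v - (a : A) = -c := by rw [← hvc]; ring
        simpa [this] using hc
  have he (i : ℕ) (v : A) (hv : v ∈ V ^ i) : e i ⟨v, hv⟩ = GrPiece.mk I i ⟨v, hVi i hv⟩ := rfl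
  -- A class in Iⁱ/Iⁱ⁺¹ is sent to its unique representative in Vⁱ.
  let f (i : ℕ) : GrPiece I i →ₗ[K] A := (V ^ i).subtype ∘ₗ (e i).symm.toLinearMap
  have hf (i : ℕ) (v : A) (hv : v ∈ V ^ i) : f i (GrPiece.mk I i ⟨v, hVi i hv⟩) = v := by
    rw [← he i v hv]
    simp [f]
  have hfV (i : ℕ) (x : GrPiece I i) : f i x ∈ V ^ i := ((e i).symm x).2
  have hsurj (i : ℕ) (x : GrPiece I i) :
      ∃ (v : A) (hv : v ∈ V ^ i), x = GrPiece.mk I i ⟨v, hVi i hv⟩ :=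
    ⟨(e i).symm x, ((e i).symm x).2, by
      rw [← he i _ ((e i).symm x).2]
      simp⟩
  let F : AssociatedGraded I →ₐ[K] A := DirectSum.toAlgebra K (GrPiece I) f
    (hf 0 1 (by rw [pow_zero]; exact Submodule.one_le.1 le_rfl)) <| by
      intro i j x y
      obtain ⟨v, hv, rfl⟩ := hsurj i x
      obtain ⟨w, hw, rfl⟩ := hsurj j y
      rw [hf i v hv, hf j w hw]
      exact hf (i + j) (v * w) (by rw [pow_add]; exact Submodule.mul_mem_mul hv hw)
  have hFof (i : ℕ) (x : GrPiece I i) : F (DirectSum.of (GrPiece I) i x) = f i x :=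
    DirectSum.toAddMonoid_of (fun i => (f i).toAddMonoidHom) i x
  refine ⟨(AlgEquiv.ofBijective F ⟨?_, ?_⟩).symm⟩
  · rw [injective_iff_map_eq_zero]
    intro x hx
    have hsum : F x = ∑ j ∈ DFinsupp.support x, f j (x j) := by
      conv_lhs => rw [← DirectSum.sum_support_of x]
      rw [map_sum]
      exact Finset.sum_congr rfl fun j _ => hFof j _
    -- If the components below i vanish, those above i map into Iⁱ⁺¹; the image of the i-th then
    -- lies in Vⁱ ∩ Iⁱ⁺¹ = 0.
    have key (i : ℕ) : x i = 0 := by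
      induction i using Nat.strong_induction_on with
      | _ i ih =>
        have h0 : f i (x i) = 0 := by
          refine hinf i _ (hfV i _) ?_
          by_cases hi : i ∈ DFinsupp.support x
          · rw [hsum, ← Finset.add_sum_erase _ _ hi, add_eq_zero_iff_eq_neg] at hx
            rw [hx]
            refine neg_mem (sum_mem fun j hj => ?_)
            rcases lt_trichotomy j i with h | h | h
            · rw [ih j h, map_zero]
              exact zero_mem _
            · exact absurd h (Finset.ne_of_mem_erase hj)
            · exact Ideal.pow_le_pow_right h (hVi j (hfV j _))
          · rw [DFinsupp.notMem_support_iff.1 hi, map_zero]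
            exact zero_mem _
        exact (e i).symm.map_eq_zero_iff.1 (Subtype.ext h0)
    exact DFinsupp.ext key
  · have key (k : ℕ) : ⊤ ≤ F.range.toSubmodule ⊔ (I ^ k).restrictScalars K := by
      induction k with
      | zero => simp
      | succ k ih =>
        refine ih.trans (sup_le le_sup_left ((hsup k).trans (sup_le_sup_right ?_ _)))
        exact fun v hv => ⟨_, (hFof k _).trans (hf k v hv)⟩
    obtain ⟨N, hN⟩ := hI
    intro a
    have := key N (Submodule.mem_top (x := a))
    rw [hN] at this
    simpa using this

end Filtration

/-! ### Gorenstein algebras with Hilbert function 1, n, n, 1 -/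

section Gorenstein

variable {K A : Type*} [Field K] [CommRing A] [Algebra K A]

theorem finrank_restrictScalars_pow [Module.Finite K A] (I : Ideal A) (i : ℕ) :
    Module.finrank K ↥((I ^ i).restrictScalars K) =
      hilbertFunction K I i + Module.finrank K ↥((I ^ (i + 1)).restrictScalars K) := by
  rw [← (GrPiece.mkLinear K I i).finrank_range_add_finrank_ker,
    LinearMap.range_eq_top.2 (GrPiece.mkLinear_surjective I i), finrank_top]
  congr 1
  have hle : (I ^ (i + 1)).restrictScalars K ≤ (I ^ i).restrictScalars K :=
    fun x hx => Ideal.pow_le_pow_right (Nat.le_succ i) hx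
  have hker : (GrPiece.mkLinear K I i).ker =
      ((I ^ (i + 1)).restrictScalars K).submoduleOf ((I ^ i).restrictScalars K) := by
    ext x
    rw [LinearMap.mem_ker, GrPiece.mkLinear_eq_zero]
    rfl
  rw [hker]
  exact (Submodule.submoduleOfEquivOfLe hle).finrank_eq

/-- Equal finite dimensions force Iⁱ = Iⁱ⁺¹, so the powers are stationary from i on, and I is
nilpotent. -/
theorem pow_eq_bot_of_hilbertFunction_eq_zero [Module.Finite K A] {I : Ideal A}
    (hI : IsNilpotent I) {i : ℕ} (h : hilbertFunction K I i = 0) : I ^ i = ⊥ := by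
  have hle : I ^ i ≤ I ^ (i + 1) := by
    have h1 := finrank_restrictScalars_pow (K := K) I i
    rw [h, zero_add] at h1
    have h2 := Submodule.eq_of_le_of_finrank_eq (S₁ := (I ^ (i + 1)).restrictScalars K)
      (S₂ := (I ^ i).restrictScalars K) (fun x hx => Ideal.pow_le_pow_right (Nat.le_succ i) hx)
      h1.symm
    exact fun x hx => h2.ge hx
  obtain ⟨N, hN⟩ := hI
  have key (k : ℕ) : I ^ i ≤ I ^ (i + k) := by
    induction k with
    | zero => exact le_rfl
    | succ k ih =>
      calc I ^ i ≤ I ^ (i + 1) := hle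
        _ = I ^ i * I := pow_succ _ _
        _ ≤ I ^ (i + k) * I := Ideal.mul_mono_left ih
        _ = I ^ (i + (k + 1)) := by rw [← pow_succ, add_assoc]
  rw [eq_bot_iff]
  refine (key N).trans ?_
  rw [pow_add, hN, mul_zero, Submodule.zero_eq_bot]

/-- The tangent space of an algebra with Gorenstein Hilbert function `1, n, n, 1` lifts to a
subspace `V` of `I` whose square meets the socle `I ^ 3` trivially. -/
theorem exists_complement_sq_disjoint [CharZero K] [Module.Finite K A] {I : Ideal A}
    (h4 : I ^ 4 = ⊥) (h12 : hilbertFunction K I 1 = hilbertFunction K I 2)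
    (h3 : Module.finrank K ↥((I ^ 3).restrictScalars K) = 1)
    (hsoc : ∀ x ∈ I ^ 2, (∀ y ∈ I, y * x = 0) → x ∈ I ^ 3) :
    ∃ V ≤ I.restrictScalars K, I.restrictScalars K ≤ V ⊔ (I ^ 2).restrictScalars K ∧
      (∀ x ∈ V, x ∈ I ^ 2 → x = 0) ∧ ∀ x ∈ V ^ 2, x ∈ I ^ 3 → x = 0 := by
  have hmul {i j : ℕ} {a b : A} (ha : a ∈ I ^ i) (hb : b ∈ I ^ j) : a * b ∈ I ^ (i + j) := by
    rw [pow_add]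
    exact Ideal.mul_mem_mul ha hb
  have hone {a : A} (ha : a ∈ I) : a ∈ I ^ 1 := by rwa [pow_one]
  have hzero {a : A} (ha : a ∈ I ^ 4) : a = 0 := by rwa [h4] at ha
  -- a functional which is injective on the socle
  obtain ⟨φ, hφ⟩ : ∃ φ : A →ₗ[K] K, ∀ x ∈ I ^ 3, φ x = 0 → x = 0 := by
    obtain ⟨e⟩ := FiniteDimensional.nonempty_linearEquiv_of_finrank_eq
      (h3.trans (Module.finrank_self K).symm)
    obtain ⟨φ, hφ⟩ := LinearMap.exists_extend e.toLinearMap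
    refine ⟨φ, fun x hx h => ?_⟩
    have : e ⟨x, hx⟩ = 0 := by
      rw [← h]
      exact (LinearMap.congr_fun hφ ⟨x, hx⟩).symm
    exact congrArg Subtype.val (e.map_eq_zero_iff.1 this)
  -- a complement of the square
  obtain ⟨W, hW, hWI⟩ : ∃ W : Submodule K A, W ⊓ (I ^ 2).restrictScalars K = ⊥ ∧
      W ⊔ (I ^ 2).restrictScalars K = I.restrictScalars K := by
    have hle : (I ^ 2).restrictScalars K ≤ I.restrictScalars K :=
      fun x hx => Ideal.pow_le_self two_ne_zero hx
    obtain ⟨C, hC⟩ := Submodule.exists_isCompl ((I ^ 2).restrictScalars K)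
    refine ⟨C ⊓ I.restrictScalars K, ?_, ?_⟩
    · rw [eq_bot_iff, ← hC.inf_eq_bot]
      exact fun x hx => ⟨hx.2, hx.1.1⟩
    · rw [sup_comm, sup_inf_assoc_of_le C hle |>.symm, hC.sup_eq_top, top_inf_eq]
  have hWle : W ≤ I.restrictScalars K := hWI ▸ le_sup_left
  -- the pairing between `I ^ 2` and `W`
  let B : ↥((I ^ 2).restrictScalars K) →ₗ[K] Module.Dual K W :=
    ((LinearMap.mul K A).compr₂ φ).domRestrict₁₂ _ _
  have hB (q : ↥((I ^ 2).restrictScalars K)) (w : W) : B q w = φ (q * w) := rfl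
  -- If φ(qW) = 0 then qW = 0, because qW ⊆ I³; also qI² ⊆ I⁴ = 0, so q annihilates I and `hsoc`
  -- applies.
  have hker (q : ↥((I ^ 2).restrictScalars K)) : B q = 0 ↔ (q : A) ∈ I ^ 3 := by
    constructor
    · intro h
      refine hsoc q q.2 fun y hy => ?_
      obtain ⟨w, hw, u, hu, rfl⟩ := Submodule.mem_sup.1 (hWI.ge hy)
      have h1 : w * q = 0 := by
        refine hφ _ (hmul (hone (hWle hw)) q.2) ?_
        rw [mul_comm]
        exact LinearMap.congr_fun h ⟨w, hw⟩
      rw [add_mul, h1, zero_add]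
      exact hzero (hmul hu q.2)
    · intro h
      ext w
      rw [hB, hzero (hmul h (hone (hWle w.2))), map_zero, LinearMap.zero_apply]
  -- The range of `B` has dimension dim I²/I³, equal to dim I/I² = dim W.
  have hsurj : Function.Surjective B := by
    have hrW : Module.finrank K W = hilbertFunction K I 1 := by
      have h1 := finrank_restrictScalars_pow (K := K) I 1
      have h2 := Submodule.finrank_sup_add_finrank_inf_eq W ((I ^ 2).restrictScalars K)
      rw [hW, hWI, finrank_bot] at h2
      rw [pow_one] at h1
      change _ = _ + Module.finrank K ↥((I ^ 2).restrictScalars K) at h1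
      omega
    have hk : B.ker = (GrPiece.mkLinear K I 2).ker := by
      ext q
      rw [LinearMap.mem_ker, LinearMap.mem_ker, hker, GrPiece.mkLinear_eq_zero]
    have h1 := B.finrank_range_add_finrank_ker
    have h2 := (GrPiece.mkLinear K I 2).finrank_range_add_finrank_ker
    rw [LinearMap.range_eq_top.2 (GrPiece.mkLinear_surjective I 2), finrank_top] at h2
    change hilbertFunction K I 2 + _ = _ at h2
    rw [← LinearMap.range_eq_top]
    refine Submodule.eq_top_of_finrank_eq ?_
    rw [Subspace.dual_finrank_eq, hrW, h12]
    rw [hk] at h1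
    omega
  obtain ⟨g, hg⟩ := B.exists_rightInverse_of_surjective (LinearMap.range_eq_top.2 hsurj)
  -- In φ(T(v)T(w)) the two cross terms contribute -φ(vw)/2 each and cancel φ(vw), while θ(v)θ(w) ∈
  -- I⁴ = 0.
  let θ : W →ₗ[K] ↥((I ^ 2).restrictScalars K) :=
    g ∘ₗ ((-(2⁻¹ : K)) • ((LinearMap.mul K A).compr₂ φ).domRestrict₁₂ W W)
  have hθ (v w : W) : φ (θ v * w) = -2⁻¹ * φ (v * w) := by
    rw [← hB]
    exact LinearMap.congr_fun (LinearMap.congr_fun hg _) w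
  let T : W →ₗ[K] A := W.subtype + ((I ^ 2).restrictScalars K).subtype ∘ₗ θ
  have hT (w : W) : T w = w + θ w := rfl
  have hφsq (x : A) (hx : x ∈ T.range ^ 2) : φ x = 0 := by
    rw [pow_two] at hx
    induction hx using Submodule.mul_induction_on' with
    | mem_mul_mem a ha b hb =>
      obtain ⟨v, rfl⟩ := ha
      obtain ⟨w, rfl⟩ := hb
      have h1 : T v * T w = v * w + θ v * w + θ w * v + θ v * θ w := by
        rw [hT, hT]
        ring
      rw [h1, hzero (hmul (θ v).2 (θ w).2), add_zero, map_add, map_add, hθ, hθ,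
        mul_comm (w : A) v]
      ring
    | add a _ b _ ha hb => rw [map_add, ha, hb, add_zero]
  refine ⟨T.range, ?_, ?_, ?_, fun x hx hx3 => hφ x hx3 (hφsq x hx)⟩
  · rintro _ ⟨w, rfl⟩
    exact add_mem (hWle w.2) (Ideal.pow_le_self two_ne_zero (θ w).2)
  · rw [← hWI]
    refine sup_le (fun w hw => Submodule.mem_sup.2
      ⟨T ⟨w, hw⟩, ⟨_, rfl⟩, -θ ⟨w, hw⟩, neg_mem (θ ⟨w, hw⟩).2, ?_⟩) le_sup_right
    rw [hT]
    ring
  · rintro _ ⟨w, rfl⟩ h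
    have h1 : (w : A) ∈ W ⊓ (I ^ 2).restrictScalars K :=
      ⟨w.2, by simpa [hT] using sub_mem h (θ w).2⟩
    rw [hW, Submodule.mem_bot] at h1
    rw [show w = 0 from Subtype.ext h1, map_zero]

theorem isCanonicallyGraded_of_hilbertFunction [CharZero K] [IsLocalRing A] {n : ℕ}
    (hG : IsArtinianGorenstein K A)
    (hH : ∀ i, hilbertFunction K (IsLocalRing.maximalIdeal A) i =
      ([1, n, n, 1] : List ℕ).getD i 0) : IsCanonicallyGraded K A := by
  obtain ⟨hArt, hsoc⟩ := hG
  set I := IsLocalRing.maximalIdeal A with hIdef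
  have hnil : IsNilpotent I := by
    rw [hIdef, ← IsLocalRing.jacobson_eq_maximalIdeal ⊥ bot_ne_top]
    exact IsArtinianRing.isNilpotent_jacobson_bot
  have hIone : (1 : A) ∉ I := fun h => Ideal.IsPrime.ne_top' ((Ideal.eq_top_iff_one I).2 h)
  -- The value 1 of the Hilbert function at 0 says that the residue field is K.
  have h₀ : ⊤ ≤ 1 ⊔ I.restrictScalars K := by
    have h0 : Module.finrank K (GrPiece I 0) = 1 := hH 0
    have hne : GrPiece.mkLinear K I 0 ⟨1, by simp⟩ ≠ 0 := by
      rw [Ne, GrPiece.mkLinear_eq_zero, zero_add, pow_one]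
      exact hIone
    intro a _
    obtain ⟨c, hc⟩ := exists_smul_eq_of_finrank_eq_one h0 hne
      (GrPiece.mkLinear K I 0 ⟨a, by simp⟩)
    rw [← sub_eq_zero, ← map_smul, ← map_sub, GrPiece.mkLinear_eq_zero, zero_add, pow_one] at hc
    refine Submodule.mem_sup.2 ⟨algebraMap K A c, Submodule.mem_one.2 ⟨c, rfl⟩,
      -(c • 1 - a), neg_mem hc, ?_⟩
    rw [Algebra.algebraMap_eq_smul_one]
    ring
  have : Module.Finite K A :=
    finite_of_isNilpotent hnil ((isNoetherianRing_iff_ideal_fg A).1 inferInstance I) h₀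
  have h4 : I ^ 4 = ⊥ := pow_eq_bot_of_hilbertFunction_eq_zero (K := K) hnil (hH 4)
  have h3 : Module.finrank K ↥((I ^ 3).restrictScalars K) = 1 := by
    rw [finrank_restrictScalars_pow, h4, hH 3, Submodule.restrictScalars_bot, finrank_bot]
    simp
  -- I³ lies in the socle as I⁴ = 0, and both are one-dimensional, so they coincide.
  have hmem (x : A) (hx : ∀ y ∈ I, y * x = 0) : x ∈ I ^ 3 := by
    have hle : (I ^ 3).restrictScalars K ≤
        ((⊥ : Ideal A).colon (I : Set A)).restrictScalars K := by
      intro x hx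
      rw [Submodule.restrictScalars_mem, Submodule.mem_colon]
      intro y hy
      have := Ideal.mul_mem_mul hx hy
      rwa [← pow_succ, h4] at this
    have := Submodule.eq_of_le_of_finrank_eq hle (h3.trans hsoc.symm)
    refine this.ge ?_
    rw [Submodule.restrictScalars_mem, Submodule.mem_colon]
    intro y hy
    rw [smul_eq_mul, mul_comm, hx y hy]
    exact zero_mem _
  obtain ⟨V, hV, h₁, hV1, hV2⟩ := exists_complement_sq_disjoint h4 ((hH 1).trans (hH 2).symm) h3
    fun x _ => hmem x
  refine nonempty_algEquiv_associatedGraded hnil hV (restrictScalars_pow_le_sup hV h₀ h₁) ?_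
  have hbig (i : ℕ) (x : A) (hx : x ∈ I ^ (i + 4)) : x = 0 := by
    rwa [pow_add, h4, Ideal.mul_bot] at hx
  rintro (_ | _ | _ | i) x hx hxI
  · rw [pow_zero] at hx
    obtain ⟨c, rfl⟩ := Submodule.mem_one.1 hx
    rw [zero_add, pow_one] at hxI
    by_contra h
    have hc : c ≠ 0 := by
      rintro rfl
      simp at h
    have := I.mul_mem_left (algebraMap K A c⁻¹) hxI
    rw [← map_mul, inv_mul_cancel₀ hc, map_one] at this
    exact hIone this
  · exact hV1 x (by simpa using hx) hxI
  · exact hV2 x hx hxI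
  · exact hbig i x hxI

end Gorenstein

/-! ### The functional of an inverse system and the matrices Δ and M -/

section Macaulay

variable {K : Type*} [Field K] {n : ℕ}

/-- The pairing `⟨f, F⟩ = (f ∘ F)(0)` between power series and polynomials. -/
noncomputable def pairing (F : MvPolynomial (Fin n) K) : MvPowerSeries (Fin n) K →ₗ[K] K where
  toFun f := (diffAct f F).coeff 0
  map_add' f g := by simp [diffAct_add]
  map_smul' c f := by simp [diffAct_smul]

theorem pairing_apply (F : MvPolynomial (Fin n) K) (f : MvPowerSeries (Fin n) K) :
    pairing F f = (diffAct f F).coeff 0 :=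
  rfl

theorem pairing_add (F G : MvPolynomial (Fin n) K) (f : MvPowerSeries (Fin n) K) :
    pairing (F + G) f = pairing F f + pairing G f := by
  simp [pairing_apply]

theorem pairing_monomial_left (β : Fin n →₀ ℕ) (f : MvPowerSeries (Fin n) K) :
    pairing (MvPolynomial.monomial β 1) f =
      ((∏ k, (β k).factorial : ℕ) : K) * MvPowerSeries.coeff β f := by
  classical
  rw [pairing_apply, diffAct_monomial, MvPolynomial.coeff_sum, Finset.sum_eq_single (β, 0)]
  · rw [MvPolynomial.coeff_monomial, if_pos rfl, mul_comm]
    simp only [Nat.descFactorial_self]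
  · rintro ⟨a, b⟩ hab hne
    rw [Finset.HasAntidiagonal.mem_antidiagonal] at hab
    rw [MvPolynomial.coeff_monomial, if_neg]
    rintro rfl
    exact hne (by simpa using hab)
  · intro h
    simp at h

theorem pairing_eq_sum (F : MvPolynomial (Fin n) K) (f : MvPowerSeries (Fin n) K) :
    pairing F f = ∑ β ∈ F.support, dualCoeff F β * MvPowerSeries.coeff β f := by
  have h (β : Fin n →₀ ℕ) : MvPolynomial.monomial β (F.coeff β) =
      F.coeff β • MvPolynomial.monomial β (1 : K) := by simp [MvPolynomial.smul_monomial]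
  conv_lhs => rw [F.as_sum]
  rw [pairing_apply, map_sum, MvPolynomial.coeff_sum]
  refine Finset.sum_congr rfl fun β _ => ?_
  rw [h, map_smul, MvPolynomial.coeff_smul, ← pairing_apply, pairing_monomial_left, dualCoeff,
    smul_eq_mul]
  ring

theorem pairing_monomial (F : MvPolynomial (Fin n) K) (γ : Fin n →₀ ℕ) :
    pairing F (MvPowerSeries.monomial γ 1) = dualCoeff F γ := by
  classical
  simp only [pairing_eq_sum, MvPowerSeries.coeff_monomial, mul_ite, mul_one, mul_zero,
    Finset.sum_ite_eq', MvPolynomial.mem_support_iff]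
  split_ifs with h
  · rfl
  · rw [dualCoeff, not_not.1 h, mul_zero]

theorem pairing_eq_zero_of_lt_order {F : MvPolynomial (Fin n) K} {f : MvPowerSeries (Fin n) K}
    (h : (F.totalDegree : ℕ∞) < f.order) : pairing F f = 0 := by
  rw [pairing_eq_sum]
  refine Finset.sum_eq_zero fun β hβ => ?_
  rw [MvPowerSeries.coeff_of_lt_order, mul_zero]
  refine lt_of_le_of_lt ?_ h
  exact_mod_cast MvPolynomial.le_totalDegree hβ

theorem dualCoeff_eq_zero {F : MvPolynomial (Fin n) K} {d : ℕ} (hF : F.IsHomogeneous d)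
    {γ : Fin n →₀ ℕ} (h : γ.degree ≠ d) : dualCoeff F γ = 0 := by
  rw [dualCoeff, hF.coeff_eq_zero h, mul_zero]

/-- Pairing f · x^γ with F gives γ! times the coefficient of y^γ in f ∘ F, and γ! is invertible in
characteristic zero. -/
theorem mem_annihilator_iff_monomial [CharZero K] {F : MvPolynomial (Fin n) K}
    {f : MvPowerSeries (Fin n) K} :
    f ∈ annihilator F ↔ ∀ γ, pairing F (f * MvPowerSeries.monomial γ 1) = 0 := by
  have h (γ : Fin n →₀ ℕ) : pairing F (f * MvPowerSeries.monomial γ 1) =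
      dualCoeff (diffAct f F) γ := by
    rw [mul_comm, pairing_apply, diffAct_mul, LinearMap.comp_apply, ← pairing_apply,
      pairing_monomial]
  simp only [h, dualCoeff, mul_eq_zero, Nat.cast_eq_zero, Finset.prod_eq_zero_iff,
    Nat.factorial_ne_zero, Finset.mem_univ, true_and, exists_false, false_or]
  change diffAct f F = 0 ↔ _
  exact MvPolynomial.ext_iff

theorem mem_annihilator_iff [CharZero K] {F : MvPolynomial (Fin n) K}
    {f : MvPowerSeries (Fin n) K} :
    f ∈ annihilator F ↔ ∀ g, pairing F (f * g) = 0 := by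
  refine ⟨fun h g => ?_, fun h => mem_annihilator_iff_monomial.2 fun γ => h _⟩
  have h0 : diffAct f F = 0 := h
  rw [mul_comm, pairing_apply, diffAct_mul, LinearMap.comp_apply, h0, map_zero,
    MvPolynomial.coeff_zero]

variable (K n) in
/-- The ideal `(x₁, …, xₙ)` of `K⟦x₁, …, xₙ⟧`. -/
noncomputable def varIdeal : Ideal (MvPowerSeries (Fin n) K) :=
  Ideal.span (Set.range MvPowerSeries.X)

theorem X_mem_varIdeal (i : Fin n) : (MvPowerSeries.X i : MvPowerSeries (Fin n) K) ∈ varIdeal K n :=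
  Ideal.subset_span ⟨i, rfl⟩

theorem le_order_of_mem_varIdeal_pow {k : ℕ} {f : MvPowerSeries (Fin n) K}
    (hf : f ∈ varIdeal K n ^ k) : (k : ℕ∞) ≤ f.order := by
  have hadd (m : ℕ∞) (a b : MvPowerSeries (Fin n) K) (ha : m ≤ a.order) (hb : m ≤ b.order) :
      m ≤ (a + b).order := (le_min ha hb).trans MvPowerSeries.min_order_le_add
  induction k generalizing f with
  | zero => simp
  | succ k ih =>
    rw [pow_succ] at hf
    induction hf using Submodule.mul_induction_on' with
    | mem_mul_mem a ha b hb =>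
      refine le_trans ?_ MvPowerSeries.le_order_mul
      have h1 : 1 ≤ b.order := by
        rw [MvPowerSeries.one_le_order_iff_constCoeff_eq_zero]
        have hle : varIdeal K n ≤ RingHom.ker (MvPowerSeries.constantCoeff (σ := Fin n) (R := K)) :=
          Ideal.span_le.2 (by rintro _ ⟨i, rfl⟩; exact MvPowerSeries.constantCoeff_X i)
        exact hle hb
      push_cast
      exact add_le_add (ih ha) h1
    | add a _ b _ ha hb => exact hadd _ a b ha hb

theorem pairing_eq_zero_of_mem_varIdeal_pow {F : MvPolynomial (Fin n) K} {k : ℕ}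
    (hF : F.totalDegree < k) {f : MvPowerSeries (Fin n) K} (hf : f ∈ varIdeal K n ^ k) :
    pairing F f = 0 :=
  pairing_eq_zero_of_lt_order
    (lt_of_lt_of_le (by exact_mod_cast hF) (le_order_of_mem_varIdeal_pow hf))

theorem varIdeal_pow_le_annihilator [CharZero K] {F : MvPolynomial (Fin n) K} {k : ℕ}
    (hF : F.totalDegree < k) : varIdeal K n ^ k ≤ annihilator F := fun _ hf =>
  mem_annihilator_iff.2 fun _ => pairing_eq_zero_of_mem_varIdeal_pow hF (Ideal.mul_mem_right _ _ hf)

theorem maxIdeal_eq_map (F : MvPolynomial (Fin n) K) :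
    maxIdeal F = (varIdeal K n).map (Ideal.Quotient.mk (annihilator F)) :=
  rfl

theorem maxIdeal_eq_span (F : MvPolynomial (Fin n) K) : maxIdeal F = Ideal.span
    (Set.range fun i => Ideal.Quotient.mk (annihilator F) (MvPowerSeries.X i)) := by
  rw [maxIdeal, Ideal.map_span, ← Set.range_comp]
  rfl

theorem isNilpotent_maxIdeal [CharZero K] (F : MvPolynomial (Fin n) K) :
    IsNilpotent (maxIdeal F) := by
  refine ⟨F.totalDegree + 1, ?_⟩
  rw [maxIdeal_eq_map, ← Ideal.map_pow, Submodule.zero_eq_bot, Ideal.map_eq_bot_iff_le_ker,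
    Ideal.mk_ker]
  exact varIdeal_pow_le_annihilator (Nat.lt_succ_self _)

theorem aeval_X_eq_coe (p : MvPolynomial (Fin n) K) :
    MvPolynomial.aeval (MvPowerSeries.X : Fin n → MvPowerSeries (Fin n) K) p = p := by
  induction p using MvPolynomial.induction_on with
  | C a => simp [MvPowerSeries.algebraMap_apply]
  | add p q hp hq => simp [hp, hq]
  | mul_X p i hp => simp [hp]

/-- Terms of degree above deg F annihilate F, so a truncation of a series represents its class. This
allows maps out of A_F to be studied on polynomials. -/
theorem mk_aeval_X_surjective [CharZero K] (F : MvPolynomial (Fin n) K) :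
    Function.Surjective fun p => Ideal.Quotient.mk (annihilator F)
      (MvPolynomial.aeval (R := K) (MvPowerSeries.X : Fin n → MvPowerSeries (Fin n) K) p) := by
  intro a
  obtain ⟨f, rfl⟩ := Ideal.Quotient.mk_surjective a
  refine ⟨MvPowerSeries.truncTotal (F.totalDegree + 1) f, ?_⟩
  dsimp only
  rw [aeval_X_eq_coe, Ideal.Quotient.eq, mem_annihilator_iff]
  refine fun g => pairing_eq_zero_of_lt_order (lt_of_lt_of_le ?_ MvPowerSeries.le_order_mul)
  refine lt_of_lt_of_le ?_ le_self_add
  refine lt_of_lt_of_le (b := ((F.totalDegree + 1 : ℕ) : ℕ∞)) ?_ (MvPowerSeries.nat_le_order ?_)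
  · exact_mod_cast Nat.lt_succ_self _
  · intro d hd
    rw [map_sub, MvPolynomial.coeff_coe, MvPowerSeries.coeff_truncTotal _ hd, sub_self]

theorem top_le_one_sup_maxIdeal [CharZero K] (F : MvPolynomial (Fin n) K) :
    (⊤ : Submodule K (MacaulayAlgebra F)) ≤ 1 ⊔ (maxIdeal F).restrictScalars K := by
  intro a _
  obtain ⟨p, rfl⟩ := mk_aeval_X_surjective F a
  dsimp only
  induction p using MvPolynomial.induction_on with
  | C c =>
    refine Submodule.mem_sup_left (Submodule.mem_one.2 ⟨c, ?_⟩)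
    rw [MvPolynomial.aeval_C]
    rfl
  | add p q hp hq =>
    rw [map_add, map_add]
    exact add_mem (hp trivial) (hq trivial)
  | mul_X p i hp =>
    refine Submodule.mem_sup_right ?_
    rw [map_mul, map_mul, MvPolynomial.aeval_X]
    exact Ideal.mul_mem_left _ _ (Ideal.mem_map_of_mem _ (X_mem_varIdeal i))

theorem degreeTwoIndex_degree (i : DegreeTwoIndex n) : i.1.degree = 2 := by
  rw [Finsupp.degree_eq_sum]
  exact (Finset.mem_finsuppAntidiag.1 i.2).1

/-- A relation c between the rows of Δ says that the linear form ∑ c_j x_j annihilates F. The n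
classes of the x_j span 𝔫/𝔫², of dimension n, hence are independent, so c = 0. -/
theorem vecMul_Delta_injective [CharZero K] {F : MvPolynomial (Fin n) K} (hF : F.IsHomogeneous 3)
    (hnd : NonDegenerate F) (c : Fin n → K) (hc : Matrix.vecMul c (Delta F) = 0) : c = 0 := by
  have hann : ∑ j, c j • MvPowerSeries.X j ∈ annihilator F := by
    refine mem_annihilator_iff_monomial.2 fun γ => ?_
    have h (j : Fin n) : pairing F (c j • MvPowerSeries.X j * MvPowerSeries.monomial γ 1) =
        c j * dualCoeff F (γ + Finsupp.single j 1) := by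
      rw [MvPowerSeries.X_def, smul_mul_assoc, MvPowerSeries.monomial_mul_monomial, map_smul,
        mul_one, pairing_monomial, smul_eq_mul, add_comm]
    rw [Finset.sum_mul, map_sum, Finset.sum_congr rfl fun j _ => h j]
    by_cases hγ : γ.degree = 2
    · refine congrFun hc ⟨γ, Finset.mem_finsuppAntidiag.2 ⟨?_, Finset.subset_univ _⟩⟩
      rw [← Finsupp.degree_eq_sum, hγ]
    · refine Finset.sum_eq_zero fun j _ => ?_
      rw [dualCoeff_eq_zero hF, mul_zero]
      rw [map_add, Finsupp.degree_single]
      omega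
  have hX (j : Fin n) : Ideal.Quotient.mk (annihilator F) (MvPowerSeries.X j) ∈ maxIdeal F ^ 1 := by
    rw [pow_one]
    exact Ideal.mem_map_of_mem _ (X_mem_varIdeal j)
  let v (j : Fin n) : GrPiece (maxIdeal F) 1 := GrPiece.mkLinear K (maxIdeal F) 1 ⟨_, hX j⟩
  have hspan : ⊤ ≤ Submodule.span K (Set.range v) := by
    intro y _
    obtain ⟨⟨a, ha⟩, rfl⟩ := GrPiece.mkLinear_surjective (K := K) (maxIdeal F) 1 y
    have ha' : a ∈ (maxIdeal F).restrictScalars K := by simpa using ha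
    obtain ⟨b, hb, d, hd, rfl⟩ := Submodule.mem_sup.1
      (restrictScalars_le_span_sup_sq (maxIdeal_eq_span F) (top_le_one_sup_maxIdeal F) ha')
    obtain ⟨t, rfl⟩ := (Submodule.mem_span_range_iff_exists_fun K).1 hb
    refine (Submodule.mem_span_range_iff_exists_fun K).2 ⟨t, ?_⟩
    simp only [v, ← map_smul]
    rw [← map_sum, ← sub_eq_zero, ← map_sub, GrPiece.mkLinear_eq_zero]
    simpa using hd
  have hli : LinearIndependent K v :=
    linearIndependent_of_top_le_span_of_card_eq_finrank hspan (by
      rw [Fintype.card_fin]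
      exact hnd.symm)
  refine funext (Fintype.linearIndependent_iff.1 hli c ?_)
  simp only [v, ← map_smul]
  rw [← map_sum, GrPiece.mkLinear_eq_zero]
  have h0 : ∑ j, c j • Ideal.Quotient.mk (annihilator F) (MvPowerSeries.X j) = 0 := by
    have := Ideal.Quotient.eq_zero_iff_mem.2 hann
    rw [map_sum] at this
    exact this
  simp [h0]

theorem mulVec_Delta_surjective [CharZero K] {F : MvPolynomial (Fin n) K} (hF : F.IsHomogeneous 3)
    (hnd : NonDegenerate F) : Function.Surjective (Delta F).mulVec := by
  have hli : LinearIndependent K (Delta F).row := by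
    rw [← Matrix.vecMul_injective_iff]
    exact (injective_iff_map_eq_zero (Delta F).vecMulLinear).2 (vecMul_Delta_injective hF hnd)
  have hr := hli.rank_matrix
  rw [Matrix.rank] at hr
  rw [← Matrix.coe_mulVecLin, ← LinearMap.range_eq_top]
  exact Submodule.eq_top_of_finrank_eq (by rw [hr, Module.finrank_fintype_fun_eq_card])

theorem rank_bigMatrix [CharZero K] {F : MvPolynomial (Fin n) K} (hF : F.IsHomogeneous 3)
    (hnd : NonDegenerate F) : (bigMatrix F).rank = (n + 1).choose 2 := by
  have hsurj : Function.Surjective (bigMatrix F).mulVec := by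
    intro t
    -- Half of `t`, extended symmetrically: row (l, j) of the system reads u l j + u j l = t, also
    -- on the diagonal, where the entries of M are doubled.
    let u (l j : Fin n) : K :=
      if h : l ≤ j then 2⁻¹ * t ⟨(l, j), h⟩ else 2⁻¹ * t ⟨(j, l), (le_of_not_ge h)⟩
    have hu (l j : Fin n) : u l j = u j l := by
      rcases lt_trichotomy l j with h | h | h
      · simp [u, h.le, h.not_ge]
      · rw [h]
      · simp [u, h.le, h.not_ge]
    choose a ha using fun l => mulVec_Delta_surjective hF hnd (u l)
    refine ⟨fun c => a c.1 c.2, funext fun p => ?_⟩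
    obtain ⟨⟨l, j⟩, hlj⟩ := p
    have h1 (l j : Fin n) : ∑ i, Delta F j i * a l i = u l j := congrFun (ha l) j
    simp only [Matrix.mulVec, dotProduct, bigMatrix, Matrix.of_apply, add_mul, ite_mul, zero_mul,
      Finset.sum_add_distrib, Fintype.sum_prod_type]
    simp only [Finset.sum_comm (s := (Finset.univ : Finset (Fin n))), Finset.sum_ite_eq',
      Finset.mem_univ, if_true, h1]
    rw [hu j l]
    simp only [u, dif_pos (show l ≤ j from hlj)]
    ring
  have hr : (bigMatrix F).rank = Fintype.card {p : Fin n × Fin n // p.1 ≤ p.2} := by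
    rw [Matrix.rank, LinearMap.range_eq_top.2 hsurj, finrank_top,
      Module.finrank_fintype_fun_eq_card]
  rw [hr, ← Fintype.card_congr Sym2.sortEquiv, Sym2.card, Fintype.card_fin]

end Macaulay

/-! ### Removing the quadratic part by a change of variables -/

section Isomorphism

variable {K : Type*} [Field K] {n : ℕ}

theorem exists_eq_single_add {σ : Type*} {β : σ →₀ ℕ} (h : β ≠ 0) :
    ∃ i γ, β = Finsupp.single i 1 + γ := by
  obtain ⟨i, hi⟩ := Finsupp.ne_iff.1 h
  exact ⟨i, β - Finsupp.single i 1, (add_tsub_cancel_of_le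
    (Finsupp.single_le_iff.2 (Nat.one_le_iff_ne_zero.2 hi))).symm⟩

theorem monomial_one_cases (β : Fin n →₀ ℕ) : MvPolynomial.monomial β (1 : K) = 1 ∨
    ∃ i γ, MvPolynomial.monomial β (1 : K) = MvPolynomial.X i * MvPolynomial.monomial γ 1 := by
  by_cases h : β = 0
  · exact Or.inl (by rw [h]; rfl)
  · obtain ⟨i, γ, rfl⟩ := exists_eq_single_add h
    refine Or.inr ⟨i, γ, ?_⟩
    rw [MvPolynomial.X, MvPolynomial.monomial_mul, mul_one]

/-- Linear maps out of a polynomial ring agree if they agree on products of at most three variables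
and on all multiples of products of four variables. -/
theorem linearMap_ext_of_degree_four {M : Type*} [AddCommMonoid M] [Module K M]
    {f g : MvPolynomial (Fin n) K →ₗ[K] M} (h0 : f 1 = g 1)
    (h1 : ∀ i, f (MvPolynomial.X i) = g (MvPolynomial.X i))
    (h2 : ∀ i j, f (MvPolynomial.X i * MvPolynomial.X j) =
      g (MvPolynomial.X i * MvPolynomial.X j))
    (h3 : ∀ i j k, f (MvPolynomial.X i * (MvPolynomial.X j * MvPolynomial.X k)) =
      g (MvPolynomial.X i * (MvPolynomial.X j * MvPolynomial.X k)))
    (h4 : ∀ i j k l p,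
      f (MvPolynomial.X i * (MvPolynomial.X j * (MvPolynomial.X k * (MvPolynomial.X l * p)))) =
      g (MvPolynomial.X i * (MvPolynomial.X j * (MvPolynomial.X k * (MvPolynomial.X l * p))))) :
    f = g := by
  refine (MvPolynomial.basisMonomials (Fin n) K).ext fun β => ?_
  rw [MvPolynomial.coe_basisMonomials]
  change f (MvPolynomial.monomial β 1) = g (MvPolynomial.monomial β 1)
  rcases monomial_one_cases (K := K) β with h | ⟨i, β, h⟩ <;> rw [h]
  · exact h0
  rcases monomial_one_cases (K := K) β with h | ⟨j, β, h⟩ <;> rw [h]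
  · rw [mul_one]
    exact h1 i
  rcases monomial_one_cases (K := K) β with h | ⟨k, β, h⟩ <;> rw [h]
  · rw [mul_one]
    exact h2 i j
  rcases monomial_one_cases (K := K) β with h | ⟨l, β, h⟩ <;> rw [h]
  · rw [mul_one]
    exact h3 i j k
  exact h4 i j k l _

variable [CharZero K]

/-- Solve Δa = b and take q = ∑ a_i xⁱ: the pairing of x_j xⁱ with F is the entry of Δ at (j, i),
and the pairing of q with the cubic F vanishes by degree. -/
theorem exists_quadric_pairing_eq {F : MvPolynomial (Fin n) K} (hF : F.IsHomogeneous 3)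
    (hnd : NonDegenerate F) (b : Fin n → K) :
    ∃ q ∈ varIdeal K n ^ 2, pairing F q = 0 ∧ ∀ i, pairing F (MvPowerSeries.X i * q) = b i := by
  obtain ⟨a, ha⟩ := mulVec_Delta_surjective hF hnd b
  refine ⟨∑ i, a i • MvPowerSeries.monomial i.1 1, sum_mem fun i _ => ?_, ?_, fun j => ?_⟩
  · rw [MvPowerSeries.smul_eq_C_mul]
    refine Ideal.mul_mem_left _ _ ?_
    have hi := degreeTwoIndex_degree i
    obtain ⟨j, γ, hγ⟩ := exists_eq_single_add (show i.1 ≠ 0 by rintro h; simp [h] at hi)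
    rw [hγ, map_add, Finsupp.degree_single] at hi
    obtain ⟨k, δ, rfl⟩ := exists_eq_single_add (show γ ≠ 0 by rintro rfl; simp at hi)
    rw [map_add, Finsupp.degree_single] at hi
    rw [(Finsupp.degree_eq_zero_iff δ).1 (by omega), add_zero] at hγ
    rw [hγ, pow_two, ← mul_one (1 : K), ← MvPowerSeries.monomial_mul_monomial]
    exact Ideal.mul_mem_mul (X_mem_varIdeal j) (X_mem_varIdeal k)
  · rw [map_sum]
    refine Finset.sum_eq_zero fun i _ => ?_
    rw [map_smul, pairing_monomial, dualCoeff_eq_zero hF (by rw [degreeTwoIndex_degree]; decide),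
      smul_zero]
  · rw [Finset.mul_sum, map_sum, ← congrFun ha j]
    refine Finset.sum_congr rfl fun i _ => ?_
    rw [mul_smul_comm, map_smul, MvPowerSeries.X_def, MvPowerSeries.monomial_mul_monomial, mul_one,
      pairing_monomial, add_comm, smul_eq_mul, mul_comm]
    rfl

/-- Surjectivity lets the test series in `mem_annihilator_iff` be taken of the form ψ(g), so the
kernel depends only on the functional p ↦ ⟨ψ(p), F⟩. -/
theorem mem_ker_mk_comp_iff {F : MvPolynomial (Fin n) K}
    {ψ : MvPolynomial (Fin n) K →ₐ[K] MvPowerSeries (Fin n) K}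
    (hψ : Function.Surjective ((Ideal.Quotient.mkₐ K (annihilator F)).comp ψ))
    (p : MvPolynomial (Fin n) K) :
    p ∈ RingHom.ker ((Ideal.Quotient.mkₐ K (annihilator F)).comp ψ) ↔
      ∀ g, pairing F (ψ (p * g)) = 0 := by
  have h : p ∈ RingHom.ker ((Ideal.Quotient.mkₐ K (annihilator F)).comp ψ) ↔
      ψ p ∈ annihilator F := by
    rw [RingHom.mem_ker]
    exact Ideal.Quotient.eq_zero_iff_mem
  rw [h, mem_annihilator_iff]
  refine ⟨fun h g => by rw [map_mul, h], fun h g => ?_⟩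
  obtain ⟨g', hg'⟩ := hψ (Ideal.Quotient.mk (annihilator F) g)
  have h1 := mem_annihilator_iff.1 (Ideal.Quotient.eq.1 hg') (ψ p)
  have h2 := h g'
  rw [map_mul] at h2
  rw [sub_mul, map_sub, mul_comm, mul_comm g] at h1
  exact (sub_eq_zero.1 h1).symm.trans h2

/-- Two algebras `A_F` and `A_G` are isomorphic if some homomorphism `ψ` from polynomials to power
series transports the functional of `G` to the functional of `F`. -/
theorem nonempty_algEquiv_of_pairing_eq {F G : MvPolynomial (Fin n) K}
    {ψ : MvPolynomial (Fin n) K →ₐ[K] MvPowerSeries (Fin n) K}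
    (hψ : Function.Surjective ((Ideal.Quotient.mkₐ K (annihilator F)).comp ψ))
    (h : ∀ p, pairing F (ψ p) = pairing G (MvPolynomial.aeval MvPowerSeries.X p)) :
    Nonempty (MacaulayAlgebra G ≃ₐ[K] MacaulayAlgebra F) := by
  have hG : Function.Surjective ((Ideal.Quotient.mkₐ K (annihilator G)).comp
    (MvPolynomial.aeval MvPowerSeries.X)) := mk_aeval_X_surjective G
  have hker : RingHom.ker ((Ideal.Quotient.mkₐ K (annihilator G)).comp
      (MvPolynomial.aeval MvPowerSeries.X)) =
      RingHom.ker ((Ideal.Quotient.mkₐ K (annihilator F)).comp ψ) := by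
    ext p
    rw [mem_ker_mk_comp_iff hG, mem_ker_mk_comp_iff hψ]
    simp only [h]
  exact ⟨(Ideal.quotientKerAlgEquivOfSurjective hG).symm.trans
    ((Ideal.quotientEquivAlgOfEq K hker).trans (Ideal.quotientKerAlgEquivOfSurjective hψ))⟩

/-- A perturbation of order two does not change the classes of the variables in 𝔫/𝔫², so the
perturbed variables still generate the algebra, 𝔫 being nilpotent. -/
theorem mk_aeval_surjective (F : MvPolynomial (Fin n) K) {x : Fin n → MvPowerSeries (Fin n) K}
    (hx : ∀ i, x i - MvPowerSeries.X i ∈ varIdeal K n ^ 2) :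
    Function.Surjective ((Ideal.Quotient.mkₐ K (annihilator F)).comp (MvPolynomial.aeval x)) := by
  let I := maxIdeal F
  let y (i : Fin n) : MacaulayAlgebra F := Ideal.Quotient.mk (annihilator F) (x i)
  have hdiff (i : Fin n) : y i - Ideal.Quotient.mk (annihilator F) (MvPowerSeries.X i) ∈ I ^ 2 := by
    change _ ∈ maxIdeal F ^ 2
    rw [maxIdeal_eq_map, ← Ideal.map_pow]
    simp only [y]
    rw [← map_sub]
    exact Ideal.mem_map_of_mem _ (hx i)
  have hV : Submodule.span K (Set.range y) ≤ I.restrictScalars K := by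
    rw [Submodule.span_le]
    rintro _ ⟨i, rfl⟩
    have := add_mem (Ideal.pow_le_self two_ne_zero (hdiff i))
      (Ideal.mem_map_of_mem (Ideal.Quotient.mk (annihilator F)) (X_mem_varIdeal i))
    rwa [sub_add_cancel] at this
  have h₀ := top_le_one_sup_maxIdeal F
  have h₁ : I.restrictScalars K ≤
      Submodule.span K (Set.range y) ⊔ (I ^ 2).restrictScalars K := by
    refine (restrictScalars_le_span_sup_sq (maxIdeal_eq_span F) h₀).trans
      (sup_le (Submodule.span_le.2 ?_) le_sup_right)
    rintro _ ⟨i, rfl⟩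
    exact Submodule.mem_sup.2 ⟨y i, Submodule.subset_span ⟨i, rfl⟩, _, neg_mem (hdiff i), by
      ring⟩
  have htop := adjoin_eq_top_of_isNilpotent (isNilpotent_maxIdeal F) hV h₀ h₁
  rw [← AlgHom.range_eq_top, eq_top_iff, ← htop]
  refine Algebra.adjoin_le fun z hz => ?_
  have hle : Submodule.span K (Set.range y) ≤ Subalgebra.toSubmodule
      ((Ideal.Quotient.mkₐ K (annihilator F)).comp (MvPolynomial.aeval x)).range := by
    rw [Submodule.span_le]
    rintro _ ⟨i, rfl⟩
    refine ⟨MvPolynomial.X i, ?_⟩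
    change Ideal.Quotient.mk (annihilator F) (MvPolynomial.aeval x (MvPolynomial.X i)) = _
    rw [MvPolynomial.aeval_X]
  exact hle hz

theorem nonempty_algEquiv_add_quadric {F₃ F₂ : MvPolynomial (Fin n) K} (h₃ : F₃.IsHomogeneous 3)
    (hnd : NonDegenerate F₃) (h₂ : F₂.IsHomogeneous 2) :
    Nonempty (MacaulayAlgebra F₃ ≃ₐ[K] MacaulayAlgebra (F₃ + F₂)) := by
  -- On x_i x_j the unwanted value ⟨x_i x_j, F₂⟩ is cancelled by ⟨x_i q_j + x_j q_i, F₃⟩, each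
  -- summand giving half.
  choose q hq2 hq0 hq using fun j => exists_quadric_pairing_eq h₃ hnd
    fun i => -2⁻¹ * pairing F₂ (MvPowerSeries.X i * MvPowerSeries.X j)
  -- On x_j the quadric q_j introduces ⟨q_j, F₂⟩, which ⟨x_j r_j, F₃⟩ cancels. The cubic x_j r_j is
  -- invisible to F₂, and in products of two or more variables it only adds terms of order at least
  -- four.
  choose r hr2 _ hr using fun j => exists_quadric_pairing_eq h₃ hnd fun _ => -pairing F₂ (q j)
  let J := varIdeal K n
  have hX (i : Fin n) : (MvPowerSeries.X i : MvPowerSeries (Fin n) K) ∈ J ^ 1 := by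
    rw [pow_one]
    exact X_mem_varIdeal i
  have hmul {i j : ℕ} {a b : MvPowerSeries (Fin n) K} (ha : a ∈ J ^ i) (hb : b ∈ J ^ j) :
      a * b ∈ J ^ (i + j) := by
    rw [pow_add]
    exact Ideal.mul_mem_mul ha hb
  let u (j : Fin n) := q j + MvPowerSeries.X j * r j
  have hu (j : Fin n) : u j ∈ J ^ 2 :=
    add_mem (hq2 j) (Ideal.pow_le_pow_right (by decide) (hmul (hX j) (hr2 j)))
  let x (j : Fin n) := MvPowerSeries.X j + u j
  have hx (j : Fin n) : x j ∈ J ^ 1 :=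
    add_mem (hX j) (Ideal.pow_le_pow_right (by decide) (hu j))
  have h3zero {f : MvPowerSeries (Fin n) K} (hf : f ∈ J ^ 4) : pairing F₃ f = 0 :=
    pairing_eq_zero_of_mem_varIdeal_pow (Nat.lt_succ_of_le h₃.totalDegree_le) hf
  have h2zero {f : MvPowerSeries (Fin n) K} (hf : f ∈ J ^ 3) : pairing F₂ f = 0 :=
    pairing_eq_zero_of_mem_varIdeal_pow (Nat.lt_succ_of_le h₂.totalDegree_le) hf
  have h2zero' {f : MvPowerSeries (Fin n) K} (hf : f ∈ J ^ 4) : pairing F₂ f = 0 :=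
    h2zero (Ideal.pow_le_pow_right (by decide) hf)
  have hone {d : ℕ} (hd : 0 ≠ d) {F : MvPolynomial (Fin n) K} (hF : F.IsHomogeneous d) :
      pairing F 1 = 0 := by
    rw [← MvPowerSeries.monomial_zero_one, pairing_monomial]
    exact dualCoeff_eq_zero hF (by simpa using hd)
  have hXzero {d : ℕ} (hd : 1 ≠ d) {F : MvPolynomial (Fin n) K} (hF : F.IsHomogeneous d)
      (i : Fin n) : pairing F (MvPowerSeries.X i) = 0 := by
    rw [MvPowerSeries.X_def, pairing_monomial]
    exact dualCoeff_eq_zero hF (by simpa using hd)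
  have hXX (i j : Fin n) : pairing F₃ (MvPowerSeries.X i * MvPowerSeries.X j) = 0 := by
    rw [MvPowerSeries.X_def, MvPowerSeries.X_def, MvPowerSeries.monomial_mul_monomial, mul_one,
      pairing_monomial]
    exact dualCoeff_eq_zero h₃ (by simp)
  refine nonempty_algEquiv_of_pairing_eq
    (mk_aeval_surjective (F₃ + F₂) (x := x) fun i => by simpa [x] using hu i) fun p => ?_
  -- Both functionals vanish on (x₁, …, xₙ)⁴, so only products of at most three variables need a
  -- computation.
  refine LinearMap.congr_fun (f := pairing (F₃ + F₂) ∘ₗ (MvPolynomial.aeval x).toLinearMap)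
    (g := pairing F₃ ∘ₗ (MvPolynomial.aeval MvPowerSeries.X).toLinearMap)
    (linearMap_ext_of_degree_four ?_ (fun i => ?_) (fun i j => ?_) (fun i j k => ?_)
      fun i j k l p => ?_) p
  all_goals simp only [LinearMap.comp_apply, AlgHom.toLinearMap_apply, pairing_add, map_one,
    map_mul, MvPolynomial.aeval_X]
  · rw [hone (by decide) h₂, add_zero]
  · simp only [x, u, map_add]
    rw [hq0, hr, hXzero (by decide) h₂, h2zero (hmul (hX i) (hr2 i))]
    ring
  · have h : x i * x j = MvPowerSeries.X i * MvPowerSeries.X j + MvPowerSeries.X i * q j +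
        MvPowerSeries.X j * q i + (MvPowerSeries.X i * MvPowerSeries.X j * r j +
        MvPowerSeries.X i * MvPowerSeries.X j * r i + u i * u j) := by
      simp only [x, u]
      ring
    have h4 : MvPowerSeries.X i * MvPowerSeries.X j * r j +
        MvPowerSeries.X i * MvPowerSeries.X j * r i + u i * u j ∈ J ^ 4 :=
      add_mem (add_mem (hmul (hmul (hX i) (hX j)) (hr2 j)) (hmul (hmul (hX i) (hX j)) (hr2 i)))
        (hmul (hu i) (hu j))
    rw [h]
    simp only [map_add (pairing F₃) _ (_ + _ + _), map_add (pairing F₂) _ (_ + _ + _)]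
    rw [h3zero h4, h2zero' h4]
    simp only [map_add]
    rw [hq, hq, hXX, h2zero (hmul (hX i) (hq2 j)), h2zero (hmul (hX j) (hq2 i)),
      mul_comm (MvPowerSeries.X j : MvPowerSeries (Fin n) K)]
    ring
  · have h : x i * (x j * x k) = MvPowerSeries.X i * (MvPowerSeries.X j * MvPowerSeries.X k) +
        (u i * MvPowerSeries.X j * MvPowerSeries.X k + x i * u j * MvPowerSeries.X k +
          x i * x j * u k) := by
      simp only [x]
      ring
    have h4 : u i * MvPowerSeries.X j * MvPowerSeries.X k + x i * u j * MvPowerSeries.X k +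
        x i * x j * u k ∈ J ^ 4 :=
      add_mem (add_mem (hmul (hmul (hu i) (hX j)) (hX k)) (hmul (hmul (hx i) (hu j)) (hX k)))
        (hmul (hmul (hx i) (hx j)) (hu k))
    rw [h, map_add (pairing F₃) _ (_ + _ + _), map_add (pairing F₂) _ (_ + _ + _), h3zero h4, h2zero' h4,
      h2zero (hmul (hX i) (hmul (hX j) (hX k)))]
    ring
  · have h4 {a b c d : MvPowerSeries (Fin n) K} (ha : a ∈ J ^ 1) (hb : b ∈ J ^ 1) (hc : c ∈ J ^ 1)
        (hd : d ∈ J ^ 1) (e : MvPowerSeries (Fin n) K) : a * (b * (c * (d * e))) ∈ J ^ 4 :=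
      hmul ha (hmul hb (hmul hc (Ideal.mul_mem_right e _ hd)))
    rw [h3zero (h4 (hx i) (hx j) (hx k) (hx l) _), h2zero' (h4 (hx i) (hx j) (hx k) (hx l) _),
      h3zero (h4 (hX i) (hX j) (hX k) (hX l) _), add_zero]

end Isomorphism

end InverseSystem

theorem theorem3p2 {K : Type*} [Field K] [IsAlgClosed K] [CharZero K] (n : ℕ) :
    (∀ (A : Type*) [CommRing A] [Algebra K A] [IsLocalRing A],
      InverseSystem.IsArtinianGorenstein K A →
      (∀ i, InverseSystem.hilbertFunction K (IsLocalRing.maximalIdeal A) i =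
        ([1, n, n, 1] : List ℕ).getD i 0) →
      InverseSystem.IsCanonicallyGraded K A) ∧
    (∀ F₃ : MvPolynomial (Fin n) K, F₃.IsHomogeneous 3 → InverseSystem.NonDegenerate F₃ →
      (∀ F₂ : MvPolynomial (Fin n) K, F₂.IsHomogeneous 2 →
        Nonempty (InverseSystem.MacaulayAlgebra F₃ ≃ₐ[K]
          InverseSystem.MacaulayAlgebra (F₃ + F₂))) ∧
      (InverseSystem.bigMatrix F₃).rank = (n + 1).choose 2) :=
  ⟨fun _ _ _ _ hG hH => InverseSystem.isCanonicallyGraded_of_hilbertFunction hG hH,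
    fun _ h₃ hnd => ⟨fun _ h₂ => InverseSystem.nonempty_algEquiv_add_quadric h₃ hnd h₂,
      InverseSystem.rank_bigMatrix h₃ hnd⟩⟩
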